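/- Let $p$ be a prime. Let $\mathcal G$ be a finite directed graph (loops and multiple edges allowed) whose edges are labeled by elements of an alphabet $\mathcal A$, let $v$ be a vertex of $\mathcal G$, and let $\bar f_p:\mathcal A\to\{0,1,\dots,p-1\}$. Let $Y\subseteq\mathbb Z_p$ be the set of all $\sum_{k\ge 0}\bar f_p(a_k)p^k$, where $(a_k)_{k\ge0}$ runs over the label sequences of the infinite directed walks in $\mathcal G$ that start at $v$. Suppose that this is a standard presentation of $Y$, that is: $\bar f_p$ is injective; at each vertex all exiting edges have different labels; and every vertex can be reached from $v$ by a directed path. Suppose also that $Y\neq\emptyset$. Write $d_H$ for Hausdorff dimension. (1) The map $\iota_p:\mathbb Z_p\to[0,1]$, $\iota_p\bigl(\sum_{k\ge0}\alpha_kp^k\bigr)=\sum_{k\ge0}\alpha_kp^{-k-1}$ (with digits $\alpha_k\in\{0,\dots,p-1\}$), is continuous, and $K_0:=\iota_p(Y)$ is a construction sub-object of a Mauldin–Williams graph-directed construction in $\mathbb R$ all of whose edge maps are similarities of ratio $1/p$. Here a Mauldin–Williams graph-directed construction in $\mathbb R$ consists of: compact sets $J_1,\dots,J_n\subset\mathbb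 R$ with nonempty interior such that $J_i\cap J_j$ has empty interior for $i\ne j$; a directed graph $G$ on $\{1,\dots,n\}$ with at most one edge from $i$ to $j$ for each pair $(i,j)$, in which every vertex has an exit edge and whose underlying undirected graph is connected; and for each edge $(i,j)$ a similarity $T_{i,j}:\mathbb R\to\mathbb R$ of ratio $t_{i,j}>0$, such that $T_{i,j}(J_j)\subseteq J_i$, for each $i$ the sets $T_{i,j}(J_j)$ with $(i,j)\in G$ have pairwise intersections with empty interior, and the product of the ratios along every directed cycle is less than $1$. Its construction sub-objects are the entries of the unique vector $(K_1,\dots,K_n)$ of nonempty compact sets $K_i\subseteq J_i$ with $K_i=\bigcup_{(i,j)\in G}T_{i,j}(K_j)$ for all $i$. (2) The map $\iota_p$ preserves Hausdorff dimension: $d_H(S)=d_H(\iota_p(S))$ for every $S\subseteq\mathbb Z_p$. In particular $d_H(Y)=d_H(K_0)$. (3) Let $A(\mathcal G)$ be the adjacency matrix, whose $(i,j)$ entry is the number of edges of $\mathcal G$ from $i$ to $j$, and let $\sigma(A(\mathcal G))$ be its spectral radius. Then $\sigma(A(\mathcal G))\ge1$ and $$d_H(Y)=d_H(K_0)=\log_p\sigma(A(\mathcal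 G)).$$ -/

import Mathlib

/-- A directed graph with vertex set `V` and edge set `E` (loops and multiple edges allowed),
whose edges are labeled by elements of `A`. -/
structure LabeledGraph (V E A : Type*) where
  src : E → V
  tgt : E → V
  label : E → A

namespace LabeledGraph

variable {V E A : Type*}

/-- The path set of the pointed graph `(G, v)`: the label sequences of all infinite walks
in `G` that start at `v`. -/
def pathSet (G : LabeledGraph V E A) (v : V) : Set (ℕ → A) :=
  {s | ∃ e : ℕ → E, G.src (e 0) = v ∧ (∀ k, G.tgt (e k) = G.src (e (k + 1))) ∧
    ∀ k, G.label (e k) = s k}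

/-- At each vertex, all exiting edges have different labels. -/
def RightResolving (G : LabeledGraph V E A) : Prop :=
  ∀ e e' : E, G.src e = G.src e' → G.label e = G.label e' → e = e'

/-- Every vertex can be reached by a directed path from `v`. -/
def ReachableFrom (G : LabeledGraph V E A) (v : V) : Prop :=
  ∀ w : V, Relation.ReflTransGen (fun a b => ∃ e : E, G.src e = a ∧ G.tgt e = b) v w

/-- The adjacency matrix: its `(i, j)` entry is the number of edges from `i` to `j`. -/
noncomputable def adjacency (G : LabeledGraph V E A) : Matrix V V ℕ :=
  Matrix.of fun i j => Nat.card {e : E // G.src e = i ∧ G.tgt e = j}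

/-- The spectral radius of the adjacency matrix: the largest absolute value of its
complex eigenvalues. -/
noncomputable def adjSpectralRadius [Fintype V] [DecidableEq V] (G : LabeledGraph V E A) : ℝ :=
  (spectralRadius ℂ (G.adjacency.map (Nat.cast : ℕ → ℂ))).toReal

end LabeledGraph

/-- The `p`-adic integer `∑ aₖ pᵏ` with digit sequence `a`. -/
noncomputable def padicOfDigits (p : ℕ) [Fact p.Prime] (a : ℕ → Fin p) : ℤ_[p] :=
  ∑' k, ((a k : ℕ) : ℤ_[p]) * (p : ℤ_[p]) ^ k

/-- The `k`-th `p`-adic digit of `x`; here `x.appr (k + 1)` is the representative of `x`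
modulo `p ^ (k + 1)` in `{0, …, p ^ (k + 1) - 1}`, and `/` is division with remainder. -/
noncomputable def padicDigit (p : ℕ) [Fact p.Prime] (x : ℤ_[p]) (k : ℕ) : ℕ :=
  x.appr (k + 1) / p ^ k

/-- The map `ℤ_p → ℝ` that sends `∑ αₖ pᵏ` to `∑ αₖ / p ^ (k + 1)`. -/
noncomputable def iotaP (p : ℕ) [Fact p.Prime] (x : ℤ_[p]) : ℝ :=
  ∑' k, (padicDigit p x k : ℝ) / (p : ℝ) ^ (k + 1)

/-- `(f, G, v)` is a presentation of `Y ⊆ ℤ_p` as a `p`-adic path set fractal, and it is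
standard: injective, right-resolving and reachable. -/
structure IsStandardPresentation (p : ℕ) [Fact p.Prime] {V E A : Type*} (f : A → Fin p)
    (G : LabeledGraph V E A) (v : V) (Y : Set ℤ_[p]) : Prop where
  presents : Y = (fun s : ℕ → A => padicOfDigits p (fun k => f (s k))) '' G.pathSet v
  injective : Function.Injective f
  rightResolving : G.RightResolving
  reachable : G.ReachableFrom v

/-- Two sets overlap if their intersection has nonempty interior. -/
def Overlap {X : Type*} [TopologicalSpace X] (S T : Set X) : Prop :=
  (interior (S ∩ T)).Nonempty

/-- A Mauldin–Williams geometric graph-directed construction in the Euclidean space `X`, with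
vertices `0, …, n - 1`. The graph has at most one edge from `i` to `j`; `T i j` and `t i j` matter
only if `(i, j)` is an edge. -/
structure GraphDirectedConstruction (X : Type*) [NormedAddCommGroup X] [InnerProductSpace ℝ X]
    [FiniteDimensional ℝ X] (n : ℕ) where
  J : Fin n → Set X
  graph : Digraph (Fin n)
  T : Fin n → Fin n → X → X
  t : Fin n → Fin n → ℝ
  isCompact_J : ∀ i, IsCompact (J i)
  interior_J : ∀ i, (interior (J i)).Nonempty
  nonoverlap_J : ∀ i j, i ≠ j → ¬ Overlap (J i) (J j)
  exit_edge : ∀ i, ∃ j, graph.Adj i j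
  connected : (SimpleGraph.fromRel graph.Adj).Connected
  ratio_pos : ∀ i j, graph.Adj i j → 0 < t i j
  similarity : ∀ i j, graph.Adj i j → ∀ x y, dist (T i j x) (T i j y) = t i j * dist x y
  nonoverlap_T : ∀ i j k, graph.Adj i j → graph.Adj i k → j ≠ k →
    ¬ Overlap (T i j '' J j) (T i k '' J k)
  image_subset : ∀ i j, graph.Adj i j → T i j '' J j ⊆ J i
  /-- The product of the ratios along every directed cycle is less than `1`. -/
  cycle_contract : ∀ (q : ℕ) (c : ℕ → Fin n), 0 < q → c q = c 0 →
    (∀ k < q, graph.Adj (c k) (c (k + 1))) → ∏ k ∈ Finset.range q, t (c k) (c (k + 1)) < 1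

namespace GraphDirectedConstruction

variable {X : Type*} [NormedAddCommGroup X] [InnerProductSpace ℝ X] [FiniteDimensional ℝ X]
  {n : ℕ}

/-- `K` is a vector of nonempty compact sets `K i ⊆ J i` that satisfies
`K i = ⋃ {T i j (K j) | (i, j) an edge}` for all `i`. -/
structure IsInvariant (C : GraphDirectedConstruction X n) (K : Fin n → Set X) : Prop where
  isCompact : ∀ i, IsCompact (K i)
  nonempty : ∀ i, (K i).Nonempty
  subset : ∀ i, K i ⊆ C.J i
  eq_iUnion : ∀ i, K i = ⋃ (j : Fin n) (_ : C.graph.Adj i j), C.T i j '' K j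

/-- `S` is the construction sub-object at the vertex `i`: the `i`-th entry of the unique
invariant vector of nonempty compact sets. -/
def IsSubobject (C : GraphDirectedConstruction X n) (i : Fin n) (S : Set X) : Prop :=
  ∃ K : Fin n → Set X, C.IsInvariant K ∧ (∀ K', C.IsInvariant K' → K' = K) ∧ K i = S

end GraphDirectedConstruction

/-! The map `iotaP p` is `1`-Lipschitz, and the preimage of a set of diameter at most `p⁻ⁿ` meets at
most five `p`-adic balls of radius `p⁻ⁿ`, one for each base-`p` interval of level `n` that is close
enough. Covers therefore transfer in both directions, and Hausdorff dimension is preserved.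

The dimension is computed in `ℤ_[p]`. Each ball of radius `p⁻ᵐ` that meets `Y` comes from a path of
length `m` from `v`, and the entries of the power `Aᵐ` of the adjacency matrix count these paths, so
Gelfand's formula gives the upper bound. For the lower bound, the phases of the eigenvalues return
near `1` simultaneously for infinitely many `m`, so that `tr Aᵐ`, and with it some diagonal entry
`L = (Aᵐ)_{ww}`, is at least `rᵐ` when `r` is less than the spectral radius. Different loops at `w`
are separated by their digits, so that concatenating the `L` loops freely gives a self-similar set
with `L` disjoint pieces of ratio `p⁻ᵐ`. A copy of it lies in `Y`, as `w` is reachable from `v`.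

The vertices of the graph-directed construction are the live edges of the labeled graph, together
with an initial state; its invariant vector is unique since all its maps contract by `1 / p`. -/

open Filter Topology
open scoped NNReal ENNReal

section Spectral

open Polynomial

variable {ι : Type*} [Fintype ι] [DecidableEq ι]

theorem det_aeval_eq_prod_roots_charpoly {K : Type*} [Field K] [IsAlgClosed K]
    (M : Matrix ι ι K) (q : K[X]) :
    (aeval M q).det = (M.charpoly.roots.map fun r => q.eval r).prod := by
  have hcard : Multiset.card M.charpoly.roots = Fintype.card ι := by
    rw [IsAlgClosed.card_roots_eq_natDegree, M.charpoly_natDegree_eq_dim]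
  have hlin (a : K) : (aeval M (X - C a)).det = (M.charpoly.roots.map fun r => r - a).prod := by
    rw [map_sub, aeval_X, aeval_C, ← neg_sub, Matrix.det_neg]
    change _ * (Matrix.scalar ι a - M).det = _
    rw [← Matrix.eval_charpoly,
      (IsAlgClosed.splits M.charpoly).eval_eq_prod_roots_of_monic M.charpoly_monic, ← hcard,
      ← Multiset.card_map (fun r => a - r), ← Multiset.prod_map_neg, Multiset.map_map]
    simp only [Function.comp_def, neg_sub]
  rw [(IsAlgClosed.splits q).eq_prod_roots]
  generalize q.roots = s
  induction s using Multiset.induction_on with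
  | empty => simp [hcard, Matrix.algebraMap_eq_diagonal]
  | cons a s ih =>
    rw [Multiset.map_cons, Multiset.prod_cons, mul_left_comm, map_mul, Matrix.det_mul, ih, hlin]
    simp only [eval_mul, eval_sub, eval_X, eval_C, Multiset.prod_map_mul]

theorem roots_charpoly_pow {K : Type*} [Field K] [IsAlgClosed K] (M : Matrix ι ι K) (m : ℕ) :
    (M ^ m).charpoly.roots = M.charpoly.roots.map (· ^ m) := by
  have hprod : (M ^ m).charpoly = ((M.charpoly.roots.map (· ^ m)).map fun r => X - C r).prod := by
    refine Polynomial.funext fun c => ?_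
    have h := det_aeval_eq_prod_roots_charpoly M (C c - X ^ m)
    rw [Matrix.eval_charpoly]
    simp only [eval_multiset_prod, Multiset.map_map, Function.comp_def, eval_sub, eval_X, eval_C]
    simpa [Matrix.algebraMap_eq_diagonal, Pi.algebraMap_def] using h
  rw [hprod, roots_multiset_prod_X_sub_C]

theorem trace_pow_eq_sum_roots_charpoly {K : Type*} [Field K] [IsAlgClosed K]
    (M : Matrix ι ι K) (m : ℕ) :
    (M ^ m).trace = (M.charpoly.roots.map (· ^ m)).sum := by
  rw [Matrix.trace_eq_sum_roots_charpoly, roots_charpoly_pow]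

theorem frequently_half_norm_pow_le_re_pow (s : Finset ℂ) :
    ∃ᶠ m : ℕ in atTop, ∀ z ∈ s, ‖z‖ ^ m / 2 ≤ (z ^ m).re := by
  -- The powers of the phases `z / ‖z‖` return to `1` simultaneously, as a torus is compact.
  let u : s → Circle := fun z => Circle.exp (Complex.arg z)
  let U : Set (s → Circle) := {w | ∀ z, 1 / 2 < (w z : ℂ).re}
  have hU : U ∈ 𝓝 1 := by
    refine IsOpen.mem_nhds ?_ fun _ => by norm_num
    simp only [U, Set.ofPred_forall]
    exact isOpen_iInter_of_finite fun z => isOpen_lt continuous_const (by fun_prop)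
  refine ((mapClusterPt_one_atTop_pow u).frequently hU).mono fun m hm z hz => ?_
  have hpolar : z ^ m = ((‖z‖ ^ m : ℝ) : ℂ) * ((u ^ m) ⟨z, hz⟩ : Circle) := by
    conv_lhs => rw [← Complex.norm_mul_exp_arg_mul_I z, mul_pow]
    simp [u]
  rw [hpolar, Complex.re_ofReal_mul, div_eq_mul_one_div]
  gcongr
  exact (hm ⟨z, hz⟩).le

theorem frequently_half_norm_pow_le_re_trace_pow (M : Matrix ι ι ℂ) {z : ℂ}
    (hz : z ∈ spectrum ℂ M) : ∃ᶠ m : ℕ in atTop, ‖z‖ ^ m / 2 ≤ (M ^ m).trace.re := by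
  have hroot : z ∈ M.charpoly.roots :=
    (mem_roots M.charpoly_monic.ne_zero).2 (Matrix.mem_spectrum_iff_isRoot_charpoly.1 hz)
  refine (frequently_half_norm_pow_le_re_pow M.charpoly.roots.toFinset).mono fun m hm => ?_
  simp only [Multiset.mem_toFinset] at hm
  have hre : (M ^ m).trace.re = (M.charpoly.roots.map fun y => (y ^ m).re).sum := by
    rw [trace_pow_eq_sum_roots_charpoly, ← Complex.coe_reAddGroupHom, map_multiset_sum,
      Multiset.map_map]
    rfl
  rw [hre]
  refine (hm z hroot).trans (Multiset.single_le_sum ?_ _ (Multiset.mem_map_of_mem _ hroot))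
  simp only [Multiset.mem_map]
  rintro _ ⟨y, hy, rfl⟩
  exact le_trans (by positivity) (hm y hy)

theorem eventually_nnnorm_pow_le_of_spectralRadius_lt {R : Type*} [NormedRing R]
    [NormedAlgebra ℂ R] [CompleteSpace R] (a : R) {r : ℝ≥0} (hr : spectralRadius ℂ a < r) :
    ∀ᶠ m : ℕ in atTop, ‖a ^ m‖₊ ≤ r ^ m := by
  have hlim := spectrum.pow_nnnorm_pow_one_div_tendsto_nhds_spectralRadius a
  filter_upwards [hlim.eventually_lt_const hr, eventually_ne_atTop 0] with m hm hm0
  have := ENNReal.rpow_le_rpow hm.le (Nat.cast_nonneg (α := ℝ) m)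
  rw [← ENNReal.rpow_mul, one_div, inv_mul_cancel₀ (by exact_mod_cast hm0), ENNReal.rpow_one,
    ENNReal.rpow_natCast] at this
  exact_mod_cast this

theorem map_natCast_matrix_pow {R : Type*} [Semiring R] (B : Matrix ι ι ℕ) (m : ℕ) :
    B.map (Nat.cast : ℕ → R) ^ m = (B ^ m).map (Nat.cast : ℕ → R) :=
  (map_pow (Nat.castRingHom R).mapMatrix B m).symm

section NormedMatrix

attribute [local instance] Matrix.linftyOpNormedRing Matrix.linftyOpNormedAlgebra

theorem eventually_sum_pow_apply_le (B : Matrix ι ι ℕ) {r : ℝ≥0}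
    (hr : spectralRadius ℂ (B.map (Nat.cast : ℕ → ℂ)) < r) :
    ∀ᶠ m : ℕ in atTop, ∀ i, ((∑ j, (B ^ m) i j : ℕ) : ℝ≥0) ≤ r ^ m := by
  have : CompleteSpace (Matrix ι ι ℂ) := FiniteDimensional.complete ℂ _
  filter_upwards [eventually_nnnorm_pow_le_of_spectralRadius_lt _ hr] with m hm i
  rw [map_natCast_matrix_pow, Matrix.linfty_opNNNorm_def] at hm
  refine le_trans (le_of_eq ?_) ((Finset.le_sup (Finset.mem_univ i)).trans hm)
  simp

theorem one_le_spectralRadius_of_frequently_pow_ne_zero (B : Matrix ι ι ℕ)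
    (h : ∃ᶠ m : ℕ in atTop, B ^ m ≠ 0) : 1 ≤ spectralRadius ℂ (B.map (Nat.cast : ℕ → ℂ)) := by
  by_contra! hlt
  obtain ⟨r, hr, hr1⟩ := ENNReal.lt_iff_exists_nnreal_btwn.1 hlt
  obtain ⟨m, hB, hm, hm0⟩ := (h.and_eventually
    ((eventually_sum_pow_apply_le B hr).and (eventually_ne_atTop 0))).exists
  refine hB (Matrix.ext fun i j => ?_)
  have hsum : ∑ j, (B ^ m) i j < 1 := by
    exact_mod_cast (hm i).trans_lt (pow_lt_one₀ zero_le (by exact_mod_cast hr1) hm0)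
  exact Finset.sum_eq_zero_iff.1 (Nat.lt_one_iff.1 hsum) j (Finset.mem_univ j)

theorem exists_pow_le_pow_apply_self (B : Matrix ι ι ℕ) {r : ℝ≥0}
    (hr : r < spectralRadius ℂ (B.map (Nat.cast : ℕ → ℂ))) :
    ∃ m ≠ 0, ∃ i, r ^ m ≤ ((B ^ m) i i : ℝ≥0) := by
  obtain ⟨z, hz, hrz⟩ := lt_biSup_iff.1 hr
  have hrz' : (r : ℝ) < ‖z‖ := by exact_mod_cast hrz
  have hz0 : 0 < ‖z‖ := r.coe_nonneg.trans_lt hrz'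
  have hlim : Tendsto (fun m => (Fintype.card ι : ℝ) * (r / ‖z‖) ^ m) atTop (𝓝 0) := by
    simpa using (tendsto_pow_atTop_nhds_zero_of_lt_one (by positivity)
      ((div_lt_one hz0).2 hrz')).const_mul (Fintype.card ι : ℝ)
  obtain ⟨m, htr, hm, hm0⟩ := ((frequently_half_norm_pow_le_re_trace_pow _ hz).and_eventually
    ((hlim.eventually_lt_const (one_half_pos)).and (eventually_ne_atTop 0))).exists
  refine ⟨m, hm0, ?_⟩
  by_contra! hlt
  have htrace : ‖z‖ ^ m / 2 ≤ ∑ i, ((B ^ m) i i : ℝ) := by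
    simpa [map_natCast_matrix_pow, Matrix.trace] using htr
  have hsum : ∑ i, ((B ^ m) i i : ℝ) ≤ Fintype.card ι * r ^ m := by
    simpa using Finset.sum_le_card_nsmul Finset.univ (fun i => ((B ^ m) i i : ℝ)) (r ^ m)
      fun i _ => by exact_mod_cast (hlt i).le
  rw [div_pow, ← mul_div_assoc, div_lt_iff₀ (by positivity)] at hm
  linarith

theorem spectralRadius_ne_top (M : Matrix ι ι ℂ) : spectralRadius ℂ M ≠ ⊤ := by
  refine ne_top_of_le_ne_top ?_ (spectrum.spectralRadius_le_pow_nnnorm_pow_one_div ℂ M 0)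
  finiteness

end NormedMatrix

end Spectral

section Digits

variable {p : ℕ} [hp : Fact p.Prime]

theorem norm_sub_le_iff_appr_eq (x y : ℤ_[p]) (n : ℕ) :
    ‖x - y‖ ≤ ((p : ℝ) ^ n)⁻¹ ↔ x.appr n = y.appr n := by
  rw [← zpow_natCast, ← zpow_neg, PadicInt.norm_le_pow_iff_mem_span_pow, ← PadicInt.ker_toZModPow,
    RingHom.sub_mem_ker_iff]
  change (x.appr n : ZMod (p ^ n)) = (y.appr n : ZMod (p ^ n)) ↔ _
  rw [ZMod.natCast_eq_natCast_iff', Nat.mod_eq_of_lt (PadicInt.appr_lt x n),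
    Nat.mod_eq_of_lt (PadicInt.appr_lt y n)]

theorem appr_natCast (m n : ℕ) : (m : ℤ_[p]).appr n = m % p ^ n := by
  have h : PadicInt.toZModPow n (m : ℤ_[p]) = ((m : ℤ_[p]).appr n : ZMod (p ^ n)) := rfl
  rw [map_natCast, ZMod.natCast_eq_natCast_iff', Nat.mod_eq_of_lt (PadicInt.appr_lt _ n)] at h
  exact h.symm

theorem summable_digits_mul_pow (a : ℕ → Fin p) :
    Summable fun k => ((a k : ℕ) : ℤ_[p]) * (p : ℤ_[p]) ^ k := by
  refine Summable.of_norm_bounded (summable_geometric_of_lt_one (r := (p : ℝ)⁻¹) (by positivity)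
    (inv_lt_one_of_one_lt₀ (by exact_mod_cast hp.out.one_lt))) fun k => ?_
  rw [norm_mul, norm_pow, PadicInt.norm_p]
  exact mul_le_of_le_one_left (by positivity) (PadicInt.norm_le_one _)

theorem padicOfDigits_eq_sum_add (a : ℕ → Fin p) (n : ℕ) :
    padicOfDigits p a = ((∑ k ∈ Finset.range n, (a k : ℕ) * p ^ k : ℕ) : ℤ_[p]) +
      (p : ℤ_[p]) ^ n * padicOfDigits p (fun k => a (k + n)) := by
  rw [padicOfDigits, padicOfDigits, ← (summable_digits_mul_pow a).sum_add_tsum_nat_add n,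
    ← (summable_digits_mul_pow fun k => a (k + n)).tsum_mul_left]
  push_cast
  congr 2
  ext k
  ring

theorem sum_digits_mul_pow_lt (a : ℕ → Fin p) (n : ℕ) :
    ∑ k ∈ Finset.range n, (a k : ℕ) * p ^ k < p ^ n := by
  induction n with
  | zero => simp
  | succ n ih =>
    rw [Finset.sum_range_succ, pow_succ]
    have := (a n).2
    nlinarith [pow_pos hp.out.pos n]

theorem appr_padicOfDigits (a : ℕ → Fin p) (n : ℕ) :
    (padicOfDigits p a).appr n = ∑ k ∈ Finset.range n, (a k : ℕ) * p ^ k := by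
  rw [← Nat.mod_eq_of_lt (sum_digits_mul_pow_lt a n), ← appr_natCast, ← norm_sub_le_iff_appr_eq,
    padicOfDigits_eq_sum_add a n, add_sub_cancel_left, norm_mul, norm_pow, PadicInt.norm_p, inv_pow]
  exact mul_le_of_le_one_right (by positivity) (PadicInt.norm_le_one _)

theorem padicDigit_lt (x : ℤ_[p]) (k : ℕ) : padicDigit p x k < p := by
  rw [padicDigit, Nat.div_lt_iff_lt_mul (pow_pos hp.out.pos k), mul_comm, ← pow_succ]
  exact PadicInt.appr_lt _ _

/-- The digit sequence of a `p`-adic integer, that is, the inverse of `padicOfDigits p`. -/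
noncomputable def padicDigits (x : ℤ_[p]) (k : ℕ) : Fin p := ⟨padicDigit p x k, padicDigit_lt x k⟩

theorem padicDigits_padicOfDigits (a : ℕ → Fin p) : padicDigits (padicOfDigits p a) = a := by
  ext k
  change (padicOfDigits p a).appr (k + 1) / p ^ k = a k
  rw [appr_padicOfDigits, Finset.sum_range_succ, Nat.add_mul_div_right _ _ (pow_pos hp.out.pos k),
    Nat.div_eq_of_lt (sum_digits_mul_pow_lt a k), zero_add]

theorem sum_padicDigits (x : ℤ_[p]) (n : ℕ) :
    ∑ k ∈ Finset.range n, (padicDigits x k : ℕ) * p ^ k = x.appr n := by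
  induction n with
  | zero => simp [PadicInt.appr]
  | succ n ih =>
    have hmod : x.appr n % p ^ n = x.appr (n + 1) % p ^ n :=
      (Nat.modEq_iff_dvd' (PadicInt.appr_mono x n.le_succ)).2
        (PadicInt.dvd_appr_sub_appr x n (n + 1) n.le_succ)
    rw [Nat.mod_eq_of_lt (PadicInt.appr_lt x n)] at hmod
    rw [Finset.sum_range_succ, ih, hmod]
    exact Nat.mod_add_div' _ _

theorem norm_sub_le_iff_padicDigits (x y : ℤ_[p]) (n : ℕ) :
    ‖x - y‖ ≤ ((p : ℝ) ^ n)⁻¹ ↔ ∀ k < n, padicDigits x k = padicDigits y k := by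
  refine ⟨fun h k hk => Fin.ext ?_, fun h => ?_⟩
  · have hpow : (p : ℝ) ^ (k + 1) ≤ (p : ℝ) ^ n :=
      pow_le_pow_right₀ (by exact_mod_cast hp.out.one_le) hk
    have := (norm_sub_le_iff_appr_eq x y (k + 1)).1
      (h.trans (inv_anti₀ (by have := hp.out.pos; positivity) hpow))
    simp only [padicDigits, padicDigit, this]
  · rw [norm_sub_le_iff_appr_eq, ← sum_padicDigits x, ← sum_padicDigits y]
    exact Finset.sum_congr rfl fun k hk => by rw [h k (Finset.mem_range.1 hk)]

theorem iotaP_eq_ofDigits (x : ℤ_[p]) : iotaP p x = Real.ofDigits (padicDigits x) := by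
  simp [iotaP, Real.ofDigits, Real.ofDigitsTerm, padicDigits, div_eq_mul_inv]

theorem iotaP_padicOfDigits (a : ℕ → Fin p) : iotaP p (padicOfDigits p a) = Real.ofDigits a := by
  rw [iotaP_eq_ofDigits, padicDigits_padicOfDigits]

theorem lipschitzWith_iotaP : LipschitzWith 1 (iotaP p) := by
  refine LipschitzWith.of_dist_le_mul fun x y => ?_
  rw [NNReal.coe_one, one_mul, Real.dist_eq, dist_eq_norm, iotaP_eq_ofDigits, iotaP_eq_ofDigits]
  rcases eq_or_ne x y with rfl | hxy
  · simp
  have hnorm : ‖x - y‖ = ((p : ℝ) ^ (x - y).valuation)⁻¹ := by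
    rw [PadicInt.norm_eq_zpow_neg_valuation (sub_ne_zero.2 hxy), zpow_neg, zpow_natCast]
  rw [hnorm]
  exact Real.abs_ofDigits_sub_ofDigits_le ((norm_sub_le_iff_padicDigits x y _).1 hnorm.le)

end Digits

section HausdorffDimension

open MeasureTheory Metric

theorem exists_cover_tsum_rpow_lt {X : Type*} [EMetricSpace X] [MeasurableSpace X] [BorelSpace X]
    {S : Set X} {d : ℝ} (hd : 0 < d) {c r : ℝ≥0∞} (hc : μH[d] S < c) (hr : 0 < r) :
    ∃ (t : ℕ → Set X) (δ : ℕ → ℝ≥0∞), S ⊆ ⋃ n, t n ∧ (∀ n, 0 < δ n) ∧ (∀ n, δ n ≤ r) ∧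
      (∀ n, ediam (t n) ≤ δ n) ∧ ∑' n, δ n ^ d < c := by
  rw [Measure.hausdorffMeasure_apply] at hc
  have hlt := (le_iSup₂ (f := fun (r : ℝ≥0∞) (_ : 0 < r) =>
    ⨅ (t : ℕ → Set X) (_ : S ⊆ ⋃ n, t n) (_ : ∀ n, ediam (t n) ≤ r),
      ∑' n, ⨆ _ : (t n).Nonempty, ediam (t n) ^ d) r hr).trans_lt hc
  simp only [iInf_lt_iff] at hlt
  obtain ⟨t, hcov, hdiam, hsum⟩ := hlt
  have hsup (n : ℕ) : ediam (t n) ^ d = ⨆ _ : (t n).Nonempty, ediam (t n) ^ d := by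
    rcases (t n).eq_empty_or_nonempty with h | h <;> simp [h, hd]
  simp only [← hsup] at hsum
  obtain ⟨ε, hε0, hε⟩ := ENNReal.exists_pos_sum_of_countable' (tsub_pos_of_lt hsum).ne' ℕ
  refine ⟨t, fun n => max (ediam (t n)) (min r (ε n ^ d⁻¹)), hcov, fun n => ?_,
    fun n => max_le (hdiam n) (min_le_left _ _), fun n => le_max_left _ _, ?_⟩
  · exact lt_max_of_lt_right (lt_min hr (ENNReal.rpow_pos_of_nonneg (hε0 n) (by positivity)))
  · have hle (n : ℕ) : max (ediam (t n)) (min r (ε n ^ d⁻¹)) ^ d ≤ ediam (t n) ^ d + ε n := by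
      rw [(ENNReal.monotone_rpow_of_nonneg hd.le).map_max]
      refine max_le le_self_add (le_add_left ?_)
      exact (ENNReal.rpow_le_rpow (min_le_right _ _) hd.le).trans_eq
        (ENNReal.rpow_inv_rpow hd.ne' _)
    calc _ ≤ ∑' n, (ediam (t n) ^ d + ε n) := ENNReal.tsum_le_tsum hle
      _ = ∑' n, ediam (t n) ^ d + ∑' n, ε n := ENNReal.tsum_add
      _ < c := by rw [add_comm]; exact lt_tsub_iff_right.1 hε

section PreimageCover

variable {X Y : Type*} [EMetricSpace X] [EMetricSpace Y] {f : X → Y} {N : ℕ} {C : ℝ≥0}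
  {r : ℝ≥0∞}

theorem hausdorffMeasure_le_of_preimage_cover [MeasurableSpace X] [BorelSpace X]
    [MeasurableSpace Y] [BorelSpace Y] (hr : 0 < r)
    (h : ∀ (U : Set Y) (δ : ℝ≥0∞), 0 < δ → δ ≤ r → ediam U ≤ δ →
      ∃ B : Fin N → Set X, f ⁻¹' U ⊆ ⋃ j, B j ∧ ∀ j, ediam (B j) ≤ C * δ)
    {S : Set X} {d : ℝ} (hd : 0 < d) {c : ℝ≥0∞} (hc : μH[d] (f '' S) < c) :
    μH[d] S ≤ N * C ^ d * c := by
  have hcover (K : ℕ) : ∃ t : ℕ × Fin N → Set X, S ⊆ ⋃ i, t i ∧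
      (∀ i, ediam (t i) ≤ C * (K : ℝ≥0∞)⁻¹) ∧ ∑' i, ediam (t i) ^ d ≤ N * C ^ d * c := by
    obtain ⟨t, δ, hcov, hδ0, hδr, hdiam, hsum⟩ := exists_cover_tsum_rpow_lt hd hc
      (lt_min hr (ENNReal.inv_pos.2 (ENNReal.natCast_ne_top K)))
    choose B hBcov hBdiam using
      fun n => h (t n) (δ n) (hδ0 n) ((hδr n).trans (min_le_left _ _)) (hdiam n)
    refine ⟨fun i => B i.1 i.2, fun x hx => ?_, fun i => ?_, ?_⟩
    · obtain ⟨n, hn⟩ := Set.mem_iUnion.1 (hcov (Set.mem_image_of_mem f hx))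
      obtain ⟨j, hj⟩ := Set.mem_iUnion.1 (hBcov n hn)
      exact Set.mem_iUnion.2 ⟨(n, j), hj⟩
    · exact (hBdiam _ _).trans (by gcongr; exact (hδr _).trans (min_le_right _ _))
    · calc ∑' i : ℕ × Fin N, ediam (B i.1 i.2) ^ d
          ≤ ∑' i : ℕ × Fin N, (C * δ i.1) ^ d :=
            ENNReal.tsum_le_tsum fun i => ENNReal.rpow_le_rpow (hBdiam _ _) hd.le
        _ = N * C ^ d * ∑' n, δ n ^ d := by
            simp only [ENNReal.tsum_prod', tsum_fintype, Finset.sum_const, Finset.card_univ,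
              Fintype.card_fin, nsmul_eq_mul, ENNReal.mul_rpow_of_nonneg _ _ hd.le, mul_assoc,
              ENNReal.tsum_mul_left]
            exact mul_left_comm _ _ _
        _ ≤ N * C ^ d * c := by gcongr
  choose t hcov hdiam hsum using hcover
  have hlim : Tendsto (fun K : ℕ => C * (K : ℝ≥0∞)⁻¹) atTop (𝓝 0) := by
    simpa using ENNReal.Tendsto.const_mul ENNReal.tendsto_inv_nat_nhds_zero
      (Or.inr (ENNReal.coe_ne_top (r := C)))
  refine (Measure.hausdorffMeasure_le_liminf_tsum d S _ hlim t (.of_forall hdiam)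
    (.of_forall hcov)).trans ?_
  exact (liminf_le_liminf (.of_forall hsum)).trans_eq (liminf_const _)

theorem dimH_le_dimH_image_of_preimage_cover (hr : 0 < r)
    (h : ∀ (U : Set Y) (δ : ℝ≥0∞), 0 < δ → δ ≤ r → ediam U ≤ δ →
      ∃ B : Fin N → Set X, f ⁻¹' U ⊆ ⋃ j, B j ∧ ∀ j, ediam (B j) ≤ C * δ)
    (S : Set X) : dimH S ≤ dimH (f '' S) := by
  borelize X Y
  refine le_of_forall_gt_imp_ge_of_dense fun c hc => ?_
  obtain ⟨d, hd, hdc⟩ := ENNReal.lt_iff_exists_nnreal_btwn.1 hc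
  have hd0 : 0 < d := by exact_mod_cast zero_le.trans_lt hd
  have hle : μH[d] S ≤ N * C ^ (d : ℝ) * 1 := hausdorffMeasure_le_of_preimage_cover hr h hd0 <| by
    simp [hausdorffMeasure_of_dimH_lt hd]
  exact (dimH_le_of_hausdorffMeasure_ne_top (ne_top_of_le_ne_top (by finiteness) hle)).trans hdc.le

end PreimageCover

theorem dimH_le_of_frequently_card_mul_le {X : Type*} [EMetricSpace X] {S : Set X}
    {κ : ℕ → Type*} [∀ m, Fintype (κ m)] (t : ∀ m, κ m → Set X) {ρ C d : ℝ≥0} (hρ : ρ < 1)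
    (hcov : ∀ m, S ⊆ ⋃ l, t m l) (hdiam : ∀ m l, ediam (t m l) ≤ (ρ ^ m : ℝ≥0))
    (hcard : ∃ᶠ m in atTop, (Fintype.card (κ m) : ℝ≥0) * (ρ ^ (d : ℝ)) ^ m ≤ C) :
    dimH S ≤ d := by
  borelize X
  have hlim : Tendsto (fun m : ℕ => ((ρ ^ m : ℝ≥0) : ℝ≥0∞)) atTop (𝓝 0) :=
    ENNReal.tendsto_coe.2 (NNReal.tendsto_pow_atTop_nhds_zero_of_lt_one hρ)
  have hsum (m : ℕ) : ∑ l, ediam (t m l) ^ (d : ℝ) ≤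
      ((Fintype.card (κ m) : ℝ≥0) * (ρ ^ (d : ℝ)) ^ m : ℝ≥0) := by
    have hpow : ((ρ ^ m : ℝ≥0) : ℝ≥0∞) ^ (d : ℝ) = ((ρ ^ (d : ℝ)) ^ m : ℝ≥0) := by
      rw [← ENNReal.coe_rpow_of_nonneg _ d.coe_nonneg, ← NNReal.rpow_natCast,
        ← NNReal.rpow_natCast, ← NNReal.rpow_mul, ← NNReal.rpow_mul, mul_comm]
    calc ∑ l, ediam (t m l) ^ (d : ℝ) ≤ ∑ _l : κ m, (((ρ ^ (d : ℝ)) ^ m : ℝ≥0) : ℝ≥0∞) :=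
          Finset.sum_le_sum fun l _ =>
            (ENNReal.rpow_le_rpow (hdiam m l) d.coe_nonneg).trans_eq hpow
      _ = _ := by simp
  have hle : μH[d] S ≤ C := by
    refine (Measure.hausdorffMeasure_le_liminf_sum (d : ℝ) S _ hlim t (.of_forall hdiam)
      (.of_forall hcov)).trans (liminf_le_of_frequently_le' (hcard.mono fun m hm => ?_))
    exact (hsum m).trans (ENNReal.coe_le_coe.2 hm)
  exact dimH_le_of_hausdorffMeasure_ne_top (ne_top_of_le_ne_top ENNReal.coe_ne_top hle)

section Separated

variable {L : ℕ} {ρ : ℝ}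

theorem abs_ofDigits_sub_le_rpow_logb (hL : 1 < L) (hρ0 : 0 < ρ) (hρ1 : ρ < 1)
    {a b : ℕ → Fin L} {x : ℝ} (hx : 0 < x) (h : ∀ n : ℕ, x ≤ ρ ^ n → ∀ q < n, a q = b q) :
    |Real.ofDigits a - Real.ofDigits b| ≤ L * x ^ Real.logb ρ⁻¹ L := by
  have hL1 : (1 : ℝ) < L := by exact_mod_cast hL
  have hρ : 1 < ρ⁻¹ := (one_lt_inv₀ hρ0).2 hρ1
  have hs : 0 < Real.logb ρ⁻¹ L := Real.logb_pos hρ hL1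
  rcases le_total x 1 with hx1 | hx1
  · obtain ⟨n, hlt, hle⟩ := exists_nat_pow_near_of_lt_one hx hx1 hρ0 hρ1
    have hρs : ρ ^ Real.logb ρ⁻¹ L = (L : ℝ)⁻¹ := by
      rw [← inv_inj, ← Real.inv_rpow hρ0.le, inv_inv,
        Real.rpow_logb (by positivity) hρ.ne' (by positivity)]
    calc |Real.ofDigits a - Real.ofDigits b| ≤ ((L : ℝ) ^ n)⁻¹ :=
          Real.abs_ofDigits_sub_ofDigits_le (h n hle)
      _ = L * (ρ ^ (n + 1)) ^ Real.logb ρ⁻¹ L := by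
          rw [← Real.rpow_pow_comm hρ0.le, hρs, inv_pow, pow_succ]
          field_simp
      _ ≤ L * x ^ Real.logb ρ⁻¹ L := by gcongr
  · calc |Real.ofDigits a - Real.ofDigits b| ≤ 1 := by
          simpa using Real.abs_ofDigits_sub_ofDigits_le (n := 0) (x := a) (y := b) (by simp)
      _ ≤ L * x ^ Real.logb ρ⁻¹ L :=
          one_le_mul_of_one_le_of_one_le hL1.le (Real.one_le_rpow hx1 hs.le)

theorem ofReal_logb_le_dimH_range {X : Type*} [MetricSpace X] (hL : 1 < L) (hρ0 : 0 < ρ)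
    (hρ1 : ρ < 1) (Φ : (ℕ → Fin L) → X)
    (h : ∀ (a b : ℕ → Fin L) (n : ℕ), dist (Φ a) (Φ b) ≤ ρ ^ n → ∀ q < n, a q = b q) :
    ENNReal.ofReal (Real.logb ρ⁻¹ L) ≤ dimH (Set.range Φ) := by
  have : NeZero L := ⟨by omega⟩
  have hs : 0 < Real.logb ρ⁻¹ L :=
    Real.logb_pos ((one_lt_inv₀ hρ0).2 hρ1) (by exact_mod_cast hL)
  have hinj : Φ.Injective := fun a b hab => funext fun q =>
    h a b (q + 1) (by rw [hab, dist_self]; positivity) q q.lt_succ_self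
  -- Reading an address as a base-`L` expansion is Hölder on the range and maps it onto `[0, 1]`.
  let F : X → ℝ := fun x => Real.ofDigits (Φ.invFun x)
  have hF (a : ℕ → Fin L) : F (Φ a) = Real.ofDigits a := by
    simp only [F, Function.leftInverse_invFun hinj a]
  have hholder : HolderOnWith (L : ℝ≥0) (Real.logb ρ⁻¹ L).toNNReal F (Set.range Φ) := by
    rintro _ ⟨a, rfl⟩ _ ⟨b, rfl⟩
    rw [hF, hF, edist_nndist, edist_nndist, ← ENNReal.coe_rpow_of_nonneg _ (by positivity),
      ← ENNReal.coe_mul, ENNReal.coe_le_coe, ← NNReal.coe_le_coe]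
    push_cast
    rw [Real.coe_toNNReal _ hs.le, Real.dist_eq]
    rcases eq_or_ne a b with rfl | hab
    · rw [sub_self, abs_zero]
      positivity
    · exact abs_ofDigits_sub_le_rpow_logb hL hρ0 hρ1 (dist_pos.2 (hinj.ne hab)) (h a b)
  have honto : Set.Icc (0 : ℝ) 1 ⊆ F '' Set.range Φ := fun y hy => by
    obtain ⟨a, -, rfl⟩ := Real.ofDigits_SurjOn hL hy
    exact ⟨Φ a, ⟨a, rfl⟩, hF a⟩
  have hdim := (dimH_mono honto).trans (hholder.dimH_image_le (Real.toNNReal_pos.2 hs))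
  rw [Real.dimH_of_nonempty_interior (by simp), Module.finrank_self, Nat.cast_one,
    ENNReal.le_div_iff_mul_le (Or.inl (by simpa using hs)) (by simp), one_mul] at hdim
  exact hdim

end Separated

end HausdorffDimension

section IotaDimension

open Metric

variable {b : ℕ}

/-- The integer with base-`b` digits `a 0, …, a (n - 1)`, the digit `a 0` being the leading one.
It numbers the base-`b` interval of level `n` that contains `Real.ofDigits a`. -/
def leadingDigits (a : ℕ → Fin b) : ℕ → ℕ
  | 0 => 0
  | n + 1 => b * leadingDigits a n + a n

theorem eq_of_leadingDigits_eq {x y : ℕ → Fin b} {n : ℕ}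
    (h : leadingDigits x n = leadingDigits y n) : ∀ i < n, x i = y i := by
  induction n with
  | zero => simp
  | succ n ih =>
    have hb : 0 < b := Fin.pos (x 0)
    have hmod := congrArg (· % b) h
    have hdiv := congrArg (· / b) h
    simp only [leadingDigits, Nat.mul_add_mod, Nat.mod_eq_of_lt (Fin.is_lt _)] at hmod
    simp only [leadingDigits, Nat.mul_add_div hb, Nat.div_eq_of_lt (Fin.is_lt _), add_zero] at hdiv
    exact Nat.forall_lt_succ_right.2 ⟨ih hdiv, Fin.ext hmod⟩

theorem pow_mul_ofDigits (a : ℕ → Fin b) (n : ℕ) :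
    (b : ℝ) ^ n * Real.ofDigits a = leadingDigits a n + Real.ofDigits fun i => a (i + n) := by
  have hb : (b : ℝ) ≠ 0 := by exact_mod_cast (Fin.pos (a 0)).ne'
  have h : (b : ℝ) ^ n * ∑ i ∈ Finset.range n, Real.ofDigitsTerm a i = leadingDigits a n := by
    induction n with
    | zero => simp [leadingDigits]
    | succ n ih =>
      rw [Finset.sum_range_succ, mul_add, pow_succ', mul_assoc, ih, ← pow_succ',
        Real.ofDigitsTerm, leadingDigits, mul_left_comm, mul_inv_cancel₀ (pow_ne_zero _ hb)]
      push_cast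
      ring
  rw [Real.ofDigits_eq_sum_add_ofDigits a n, mul_add, h, mul_inv_cancel_left₀ (pow_ne_zero _ hb)]

theorem abs_leadingDigits_sub_le {x y : ℕ → Fin b} {n : ℕ}
    (h : |Real.ofDigits x - Real.ofDigits y| ≤ ((b : ℝ) ^ n)⁻¹) :
    |(leadingDigits x n : ℤ) - leadingDigits y n| ≤ 2 := by
  have hb : (0 : ℝ) < (b : ℝ) ^ n := pow_pos (by exact_mod_cast Fin.pos (x 0)) n
  have hscaled : |(b : ℝ) ^ n * Real.ofDigits x - (b : ℝ) ^ n * Real.ofDigits y| ≤ 1 := by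
    rw [← mul_sub, abs_mul, abs_of_pos hb]
    exact (mul_le_mul_of_nonneg_left h hb.le).trans_eq (mul_inv_cancel₀ hb.ne')
  have hrest (z : ℕ → Fin b) : Real.ofDigits (fun i => z (i + n)) ∈ Set.Icc 0 1 :=
    ⟨Real.ofDigits_nonneg _, Real.ofDigits_le_one _⟩
  obtain ⟨hx0, hx1⟩ := hrest x
  obtain ⟨hy0, hy1⟩ := hrest y
  rw [pow_mul_ofDigits, pow_mul_ofDigits, abs_le] at hscaled
  have : |(leadingDigits x n : ℝ) - leadingDigits y n| ≤ 2 :=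
    abs_le.2 ⟨by linarith, by linarith⟩
  exact_mod_cast this

variable {p : ℕ} [hp : Fact p.Prime]

theorem ediam_le_of_padicDigits_eq {S : Set ℤ_[p]} {n : ℕ}
    (h : ∀ x ∈ S, ∀ y ∈ S, ∀ k < n, padicDigits x k = padicDigits y k) :
    ediam S ≤ (((p : ℝ≥0)⁻¹ ^ n : ℝ≥0) : ℝ≥0∞) := by
  refine ediam_le fun x hx y hy => ?_
  rw [edist_nndist, ENNReal.coe_le_coe, ← NNReal.coe_le_coe, coe_nndist, dist_eq_norm]
  simpa using (norm_sub_le_iff_padicDigits x y n).2 (h x hx y hy)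

theorem exists_cover_iotaP_preimage {U : Set ℝ} {n : ℕ}
    (hU : ediam U ≤ (((p : ℝ≥0)⁻¹ ^ n : ℝ≥0) : ℝ≥0∞)) :
    ∃ B : Fin 5 → Set ℤ_[p], iotaP p ⁻¹' U ⊆ ⋃ j, B j ∧
      ∀ j, ediam (B j) ≤ (((p : ℝ≥0)⁻¹ ^ n : ℝ≥0) : ℝ≥0∞) := by
  rcases (iotaP p ⁻¹' U).eq_empty_or_nonempty with hempty | ⟨x₀, hx₀⟩
  · exact ⟨fun _ => ∅, by simp [hempty], by simp⟩
  let num (x : ℤ_[p]) : ℤ := leadingDigits (padicDigits x) n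
  refine ⟨fun j => {x | num x = num x₀ - 2 + (j : ℕ)}, fun x hx => ?_, fun j => ?_⟩
  · have hdist : |Real.ofDigits (padicDigits x) - Real.ofDigits (padicDigits x₀)| ≤
        ((p : ℝ) ^ n)⁻¹ := by
      have hle := (edist_le_ediam_of_mem (s := U) hx hx₀).trans hU
      rw [edist_nndist, ENNReal.coe_le_coe, ← NNReal.coe_le_coe, coe_nndist, Real.dist_eq,
        iotaP_eq_ofDigits, iotaP_eq_ofDigits] at hle
      simpa using hle
    obtain ⟨hlow, hupp⟩ : -2 ≤ num x - num x₀ ∧ num x - num x₀ ≤ 2 :=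
      abs_le.1 (abs_leadingDigits_sub_le hdist)
    refine Set.mem_iUnion.2 ⟨⟨(num x - num x₀ + 2).toNat, by omega⟩, ?_⟩
    rw [Set.mem_ofPred_eq, Int.toNat_of_nonneg (by omega)]
    ring
  · refine ediam_le_of_padicDigits_eq fun x hx y hy => eq_of_leadingDigits_eq ?_
    exact Int.ofNat_inj.1 (hx.trans hy.symm)

theorem dimH_image_iotaP (S : Set ℤ_[p]) : dimH S = dimH (iotaP p '' S) := by
  refine le_antisymm ?_ (lipschitzWith_iotaP.dimH_image_le S)
  refine dimH_le_dimH_image_of_preimage_cover (N := 5) (C := p) one_pos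
    (fun U δ hδ0 hδ1 hU => ?_) S
  lift δ to ℝ≥0 using ne_top_of_le_ne_top ENNReal.one_ne_top hδ1
  have hp0 : 0 < (p : ℝ≥0)⁻¹ := inv_pos.2 (by exact_mod_cast hp.out.pos)
  obtain ⟨n, hlt, hle⟩ := exists_nat_pow_near_of_lt_one (ENNReal.coe_pos.1 hδ0)
    (by exact_mod_cast hδ1) hp0 (inv_lt_one_of_one_lt₀ (by exact_mod_cast hp.out.one_lt))
  obtain ⟨B, hcov, hdiam⟩ := exists_cover_iotaP_preimage (hU.trans (ENNReal.coe_le_coe.2 hle))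
  refine ⟨B, hcov, fun j => (hdiam j).trans ?_⟩
  rw [← ENNReal.coe_mul, ENNReal.coe_le_coe, ← inv_mul_le_iff₀ (inv_pos.1 hp0), ← pow_succ']
  exact hlt.le

end IotaDimension

section Walks

namespace LabeledGraph

variable {V E A : Type*} {G : LabeledGraph V E A}

/-- `e` is the edge sequence of an infinite walk in `G` that starts at `v`. -/
def IsWalk (G : LabeledGraph V E A) (v : V) (e : ℕ → E) : Prop :=
  G.src (e 0) = v ∧ ∀ k, G.tgt (e k) = G.src (e (k + 1))

/-- `e` is the edge sequence of a path of length `m` from `i` to `j`. -/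
def IsPath (G : LabeledGraph V E A) : ∀ {m : ℕ}, V → (Fin m → E) → V → Prop
  | 0, i, _, j => i = j
  | _ + 1, i, e, j => G.src (e 0) = i ∧ G.IsPath (G.tgt (e 0)) (Fin.tail e) j

theorem IsWalk.tail {v : V} {e : ℕ → E} (h : G.IsWalk v e) :
    G.IsWalk (G.tgt (e 0)) fun k => e (k + 1) :=
  ⟨(h.2 0).symm, fun k => h.2 (k + 1)⟩

theorem IsWalk.cons {e₀ : E} {e : Stream' E} (h : G.IsWalk (G.tgt e₀) e) :
    G.IsWalk (G.src e₀) (Stream'.cons e₀ e) :=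
  ⟨rfl, Nat.rec h.1.symm fun k _ => h.2 k⟩

theorem IsWalk.exists_isPath {v : V} {e : ℕ → E} (h : G.IsWalk v e) (m : ℕ) :
    ∃ j, G.IsPath v (fun k : Fin m => e k) j := by
  induction m generalizing v e with
  | zero => exact ⟨v, rfl⟩
  | succ m ih => exact (ih h.tail).imp fun j hj => ⟨h.1, hj⟩

theorem isPath_succ_iff {m : ℕ} {i j : V} {e : Fin (m + 1) → E} :
    G.IsPath i e j ↔ G.src (e 0) = i ∧ (∀ k : Fin m, G.tgt (e k.castSucc) = G.src (e k.succ)) ∧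
      G.tgt (e (Fin.last m)) = j := by
  induction m generalizing i with
  | zero => simp [IsPath]
  | succ m ih =>
    rw [IsPath, ih, Fin.forall_fin_succ]
    simp only [Fin.tail, Fin.castSucc_zero, Fin.succ_last, Fin.castSucc_succ, and_assoc, eq_comm]

theorem RightResolving.eq_of_isPath (hG : G.RightResolving) {m : ℕ} {i j j' : V}
    {e e' : Fin m → E} (he : G.IsPath i e j) (he' : G.IsPath i e' j')
    (h : ∀ k, G.label (e k) = G.label (e' k)) : e = e' := by
  induction m generalizing i with
  | zero => exact Subsingleton.elim _ _
  | succ m ih =>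
    have h0 : e 0 = e' 0 := hG _ _ (he.1.trans he'.1.symm) (h 0)
    have htail : Fin.tail e = Fin.tail e' := ih he.2 (h0 ▸ he'.2) fun k => h k.succ
    rw [← Fin.cons_self_tail e, ← Fin.cons_self_tail e', h0, htail]

section Concat

variable {m : ℕ}

/-- The concatenation of a sequence of paths of length `m + 1`. -/
def concat (a : ℕ → Fin (m + 1) → E) (k : ℕ) : E := Function.uncurry a (Nat.divModEquiv (m + 1) k)

theorem concat_mul_add (a : ℕ → Fin (m + 1) → E) (q : ℕ) (r : Fin (m + 1)) :
    concat a (q * (m + 1) + r) = a q r :=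
  congrArg (fun x : ℕ × Fin (m + 1) => a x.1 x.2) ((Nat.divModEquiv (m + 1)).right_inv (q, r))

theorem isWalk_concat {w : V} {a : ℕ → Fin (m + 1) → E} (ha : ∀ q, G.IsPath w (a q) w) :
    G.IsWalk w (concat a) := by
  simp only [isPath_succ_iff] at ha
  have hstart (q : ℕ) : G.src (concat a (q * (m + 1))) = w := by
    rw [← (ha q).1, ← concat_mul_add a q 0, Fin.val_zero, add_zero]
  refine ⟨by simpa using hstart 0, fun k => ?_⟩
  obtain ⟨⟨q, r⟩, rfl⟩ := (Nat.divModEquiv (m + 1)).symm.surjective k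
  rw [Nat.divModEquiv_symm_apply, concat_mul_add]
  induction r using Fin.lastCases with
  | last => rw [(ha q).2.2, Fin.val_last, add_assoc, ← add_one_mul, hstart]
  | cast r =>
    rw [(ha q).2.1, ← concat_mul_add a q r.succ, Fin.val_castSucc, add_assoc, ← Fin.val_succ]

end Concat

variable [Fintype V]

theorem sum_tgt_eq_sum_adjacency_mul (G : LabeledGraph V E A) (i : V) (g : V → ℕ)
    [Fintype {e // G.src e = i}] :
    ∑ e : {e // G.src e = i}, g (G.tgt e) = ∑ k, G.adjacency i k * g k := by
  classical
  rw [← Finset.sum_fiberwise _ (fun e : {e // G.src e = i} => G.tgt e)]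
  refine Finset.sum_congr rfl fun k _ => ?_
  rw [Finset.sum_congr rfl fun e he => by rw [(Finset.mem_filter.1 he).2], Finset.sum_const,
    smul_eq_mul, adjacency, Matrix.of_apply, Nat.card_congr
    (Equiv.subtypeSubtypeEquivSubtypeInter (G.src · = i) (G.tgt · = k)).symm,
    Nat.card_eq_fintype_card, Fintype.card_subtype]

/-- Splitting off the first edge of a path. -/
def isPathSuccEquiv (G : LabeledGraph V E A) (m : ℕ) (i j : V) :
    {e : Fin (m + 1) → E // G.IsPath i e j} ≃
      Σ e₀ : {e₀ // G.src e₀ = i}, {e : Fin m → E // G.IsPath (G.tgt e₀) e j} where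
  toFun e := ⟨⟨e.1 0, e.2.1⟩, Fin.tail e.1, e.2.2⟩
  invFun e := ⟨Fin.cons e.1.1 e.2.1, e.1.2, e.2.2⟩
  left_inv e := Subtype.ext (Fin.cons_self_tail e.1)
  right_inv _ := rfl

theorem card_isPath [DecidableEq V] [Finite E] (G : LabeledGraph V E A) (m : ℕ) (i j : V) :
    Nat.card {e : Fin m → E // G.IsPath i e j} = (G.adjacency ^ m) i j := by
  induction m generalizing i with
  | zero =>
    rw [pow_zero, Matrix.one_apply]
    split_ifs with h <;> simp [IsPath, h]
  | succ m ih =>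
    have := Fintype.ofFinite {e₀ // G.src e₀ = i}
    rw [Nat.card_congr (G.isPathSuccEquiv m i j), Nat.card_sigma, pow_succ', Matrix.mul_apply,
      ← G.sum_tgt_eq_sum_adjacency_mul i fun k => (G.adjacency ^ m) k j]
    exact Finset.sum_congr rfl fun e _ => ih (G.tgt e)

end LabeledGraph

end Walks

section PathSetDimension

variable {p : ℕ} [hp : Fact p.Prime] {V E A : Type*} {f : A → Fin p} {G : LabeledGraph V E A}

/-- The `p`-adic path set fractal presented by `(f, G, v)`. -/
def padicPathSet (p : ℕ) [Fact p.Prime] (f : A → Fin p) (G : LabeledGraph V E A) (v : V) :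
    Set ℤ_[p] :=
  (fun s : ℕ → A => padicOfDigits p (fun k => f (s k))) '' G.pathSet v

theorem mem_padicPathSet {v : V} {x : ℤ_[p]} :
    x ∈ padicPathSet p f G v ↔
      ∃ e, G.IsWalk v e ∧ padicOfDigits p (fun k => f (G.label (e k))) = x := by
  constructor
  · rintro ⟨s, ⟨e, h0, hstep, hlabel⟩, rfl⟩
    exact ⟨e, ⟨h0, hstep⟩, by simp only [hlabel]⟩
  · rintro ⟨e, ⟨h0, hstep⟩, rfl⟩
    exact ⟨fun k => G.label (e k), ⟨e, h0, hstep, fun _ => rfl⟩, rfl⟩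

theorem dimH_padicPathSet_tgt_le (e₀ : E) :
    dimH (padicPathSet p f G (G.tgt e₀)) ≤ dimH (padicPathSet p f G (G.src e₀)) := by
  let T : ℤ_[p] → ℤ_[p] := fun x => ((f (G.label e₀) : ℕ) : ℤ_[p]) + (p : ℤ_[p]) * x
  have hT : AntilipschitzWith (p : ℝ≥0) T := by
    refine AntilipschitzWith.of_le_mul_dist fun x y => ?_
    have hp0 : (p : ℝ) ≠ 0 := by exact_mod_cast hp.out.ne_zero
    rw [dist_add_left, dist_eq_norm, dist_eq_norm, ← mul_sub, norm_mul, PadicInt.norm_p,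
      NNReal.coe_natCast, mul_inv_cancel_left₀ hp0]
  refine (hT.le_dimH_image _).trans (dimH_mono ?_)
  rintro _ ⟨x, hx, rfl⟩
  obtain ⟨e, he, rfl⟩ := mem_padicPathSet.1 hx
  refine mem_padicPathSet.2 ⟨_, he.cons, ?_⟩
  rw [padicOfDigits_eq_sum_add _ 1]
  simp [T, Stream'.cons]

theorem dimH_padicPathSet_le_of_reachable {v w : V}
    (h : Relation.ReflTransGen (fun a b => ∃ e : E, G.src e = a ∧ G.tgt e = b) v w) :
    dimH (padicPathSet p f G w) ≤ dimH (padicPathSet p f G v) := by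
  induction h with
  | refl => exact le_rfl
  | tail _ hstep ih =>
    obtain ⟨e, rfl, rfl⟩ := hstep
    exact (dimH_padicPathSet_tgt_le e).trans ih

theorem logb_card_le_dimH_padicPathSet_of_loops (hf : Function.Injective f)
    (hG : G.RightResolving) {m L : ℕ} {w : V} (hL : 1 < L)
    (loop : Fin L ↪ {e : Fin (m + 1) → E // G.IsPath w e w}) :
    ENNReal.ofReal (Real.logb (p ^ (m + 1)) L) ≤ dimH (padicPathSet p f G w) := by
  have hp1 : (1 : ℝ) < p ^ (m + 1) := one_lt_pow₀ (by exact_mod_cast hp.out.one_lt) m.succ_ne_zero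
  let walk (a : ℕ → Fin L) : ℕ → E := LabeledGraph.concat fun q => (loop (a q)).1
  let Φ (a : ℕ → Fin L) : ℤ_[p] := padicOfDigits p fun k => f (G.label (walk a k))
  have hsep (a b : ℕ → Fin L) (n : ℕ) (hab : dist (Φ a) (Φ b) ≤ ((p ^ (m + 1) : ℝ)⁻¹) ^ n)
      (q : ℕ) (hq : q < n) : a q = b q := by
    rw [inv_pow, ← pow_mul, dist_eq_norm, norm_sub_le_iff_padicDigits, padicDigits_padicOfDigits,
      padicDigits_padicOfDigits] at hab
    refine loop.injective (Subtype.ext (hG.eq_of_isPath (loop (a q)).2 (loop (b q)).2 fun r => ?_))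
    have hlabel := hf (hab (q * (m + 1) + r) (by nlinarith [r.2]))
    simpa only [walk, LabeledGraph.concat_mul_add] using hlabel
  have hrange : Set.range Φ ⊆ padicPathSet p f G w := by
    rintro _ ⟨a, rfl⟩
    exact mem_padicPathSet.2 ⟨_, LabeledGraph.isWalk_concat fun q => (loop (a q)).2, rfl⟩
  have hdim := ofReal_logb_le_dimH_range hL (inv_pos.2 (one_pos.trans hp1))
    (inv_lt_one_of_one_lt₀ hp1) Φ hsep
  rw [inv_inv] at hdim
  exact hdim.trans (dimH_mono hrange)

variable [Fintype V] [DecidableEq V]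

theorem ofReal_adjSpectralRadius (G : LabeledGraph V E A) :
    ENNReal.ofReal G.adjSpectralRadius =
      spectralRadius ℂ (G.adjacency.map (Nat.cast : ℕ → ℂ)) :=
  ENNReal.ofReal_toReal (spectralRadius_ne_top _)

variable [Finite E]

theorem le_dimH_padicPathSet_of_pow_le (hf : Function.Injective f) (hG : G.RightResolving)
    {m : ℕ} (hm : m ≠ 0) {w : V} {d : ℝ≥0}
    (h : ((p : ℝ≥0) ^ (d : ℝ)) ^ m ≤ ((G.adjacency ^ m) w w : ℝ≥0)) :
    d ≤ dimH (padicPathSet p f G w) := by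
  rcases eq_or_ne d 0 with rfl | hd
  · simp
  have hp1 : (1 : ℝ) < p := by exact_mod_cast hp.out.one_lt
  obtain ⟨m, rfl⟩ := Nat.exists_eq_succ_of_ne_zero hm
  have hL : 1 < (G.adjacency ^ (m + 1)) w w := by
    have hpow : 1 < ((p : ℝ≥0) ^ (d : ℝ)) ^ (m + 1) :=
      one_lt_pow₀ (NNReal.one_lt_rpow (by exact_mod_cast hp1) (by positivity)) m.succ_ne_zero
    exact_mod_cast hpow.trans_le h
  have hloops := logb_card_le_dimH_padicPathSet_of_loops (p := p) hf hG hL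
    (Finite.equivFinOfCardEq (G.card_isPath (m + 1) w w)).symm.toEmbedding
  refine le_trans ?_ hloops
  rw [← ENNReal.ofReal_coe_nnreal]
  refine ENNReal.ofReal_le_ofReal ?_
  rw [Real.le_logb_iff_rpow_le (one_lt_pow₀ hp1 m.succ_ne_zero) (by positivity),
    ← Real.rpow_pow_comm (by positivity)]
  exact_mod_cast h

theorem dimH_padicPathSet_le (v : V) {d : ℝ≥0}
    (hd : spectralRadius ℂ (G.adjacency.map (Nat.cast : ℕ → ℂ)) < ((p : ℝ≥0) ^ (d : ℝ) : ℝ≥0)) :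
    dimH (padicPathSet p f G v) ≤ d := by
  let κ (m : ℕ) : Type _ := Σ j, {e : Fin m → E // G.IsPath v e j}
  have (m : ℕ) : Fintype (κ m) := Fintype.ofFinite _
  let cylinder (m : ℕ) (e : κ m) : Set ℤ_[p] :=
    {x | ∀ k : Fin m, padicDigits x k = f (G.label (e.2.1 k))}
  refine dimH_le_of_frequently_card_mul_le cylinder (ρ := (p : ℝ≥0)⁻¹) (C := 1)
    (inv_lt_one_of_one_lt₀ (by exact_mod_cast hp.out.one_lt)) (fun m x hx => ?_)
    (fun m e => ediam_le_of_padicDigits_eq fun x hx y hy k hk =>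
      (hx ⟨k, hk⟩).trans (hy ⟨k, hk⟩).symm) ?_
  · obtain ⟨e, he, rfl⟩ := mem_padicPathSet.1 hx
    obtain ⟨j, hj⟩ := he.exists_isPath m
    refine Set.mem_iUnion.2 ⟨⟨j, _, hj⟩, fun k => ?_⟩
    rw [padicDigits_padicOfDigits]
  · refine Eventually.frequently ?_
    filter_upwards [eventually_sum_pow_apply_le G.adjacency hd] with m hm
    have hcard : Fintype.card (κ m) = ∑ j, (G.adjacency ^ m) v j := by
      rw [← Nat.card_eq_fintype_card, Nat.card_sigma]
      exact Finset.sum_congr rfl fun j _ => G.card_isPath m v j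
    rw [hcard, NNReal.inv_rpow, inv_pow, ← div_eq_mul_inv]
    exact div_le_one_of_le₀ (hm v) zero_le

theorem one_le_adjSpectralRadius {v : V} (h : (padicPathSet p f G v).Nonempty) :
    1 ≤ G.adjSpectralRadius := by
  obtain ⟨x, hx⟩ := h
  obtain ⟨e, he, -⟩ := mem_padicPathSet.1 hx
  rw [← ENNReal.one_le_ofReal, ofReal_adjSpectralRadius]
  refine one_le_spectralRadius_of_frequently_pow_ne_zero _ (.of_forall fun m hzero => ?_)
  obtain ⟨j, hj⟩ := he.exists_isPath m
  have hempty := Finite.card_eq_zero_iff.1 ((G.card_isPath m v j).trans (by rw [hzero]; rfl))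
  exact hempty.false ⟨_, hj⟩

theorem dimH_padicPathSet {v : V} (hf : Function.Injective f) (hG : G.RightResolving)
    (hreach : G.ReachableFrom v) (hne : (padicPathSet p f G v).Nonempty) :
    dimH (padicPathSet p f G v) = ENNReal.ofReal (Real.logb p G.adjSpectralRadius) := by
  have hp1 : (1 : ℝ) < p := by exact_mod_cast hp.out.one_lt
  have hσ1 : 1 ≤ G.adjSpectralRadius := one_le_adjSpectralRadius hne
  have hσ : 0 < G.adjSpectralRadius := one_pos.trans_le hσ1
  refine le_antisymm (le_of_forall_gt_imp_ge_of_dense fun c hc => ?_)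
    (ENNReal.le_of_forall_nnreal_lt fun d hd => ?_)
  · obtain ⟨d, hd, hdc⟩ := ENNReal.lt_iff_exists_nnreal_btwn.1 hc
    refine (dimH_padicPathSet_le v ?_).trans hdc.le
    rw [← ofReal_adjSpectralRadius, ENNReal.ofReal_lt_coe_iff hσ.le]
    exact (Real.logb_lt_iff_lt_rpow hp1 hσ).1
      ((ENNReal.ofReal_lt_coe_iff (Real.logb_nonneg hp1 hσ1)).1 hd)
  · have hlt : (((p : ℝ≥0) ^ (d : ℝ) : ℝ≥0) : ℝ≥0∞) <
        spectralRadius ℂ (G.adjacency.map (Nat.cast : ℕ → ℂ)) := by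
      rw [← ofReal_adjSpectralRadius, ENNReal.coe_lt_ofReal]
      exact (Real.lt_logb_iff_rpow_lt hp1 hσ).1 (ENNReal.coe_lt_ofReal.1 hd)
    obtain ⟨m, hm, w, hw⟩ := exists_pow_le_pow_apply_self G.adjacency hlt
    exact (le_dimH_padicPathSet_of_pow_le hf hG hm hw).trans
      (dimH_padicPathSet_le_of_reachable (hreach w))

end PathSetDimension

section Uniqueness

namespace GraphDirectedConstruction

variable {X : Type*} [NormedAddCommGroup X] [InnerProductSpace ℝ X] [FiniteDimensional ℝ X]
  {n : ℕ} {C : GraphDirectedConstruction X n} {K K' : Fin n → Set X}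

theorem IsInvariant.exists_dist_le (hK : C.IsInvariant K) (hK' : C.IsInvariant K') {ρ : ℝ}
    (ht : ∀ i j, C.graph.Adj i j → C.t i j ≤ ρ) (m : ℕ) (i : Fin n) {x : X} (hx : x ∈ K i) :
    ∃ y ∈ K' i, dist x y ≤ ρ ^ m * Metric.diam (⋃ i, C.J i) := by
  induction m generalizing i x with
  | zero =>
    obtain ⟨y, hy⟩ := hK'.nonempty i
    refine ⟨y, hy, ?_⟩
    rw [pow_zero, one_mul]
    exact Metric.dist_le_diam_of_mem (isCompact_iUnion C.isCompact_J).isBounded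
      (Set.mem_iUnion.2 ⟨i, hK.subset i hx⟩) (Set.mem_iUnion.2 ⟨i, hK'.subset i hy⟩)
  | succ m ih =>
    rw [hK.eq_iUnion i] at hx
    obtain ⟨j, hij, z, hz, rfl⟩ := Set.mem_iUnion₂.1 hx
    obtain ⟨y, hy, hzy⟩ := ih j hz
    refine ⟨C.T i j y, ?_, ?_⟩
    · rw [hK'.eq_iUnion i]
      exact Set.mem_iUnion₂.2 ⟨j, hij, y, hy, rfl⟩
    · rw [C.similarity i j hij, pow_succ', mul_assoc]
      exact mul_le_mul (ht i j hij) hzy dist_nonneg ((C.ratio_pos i j hij).le.trans (ht i j hij))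

theorem IsInvariant.subset_of_ratio_le (hK : C.IsInvariant K) (hK' : C.IsInvariant K') {ρ : ℝ}
    (hρ : ρ < 1) (ht : ∀ i j, C.graph.Adj i j → C.t i j ≤ ρ) (i : Fin n) : K i ⊆ K' i := by
  intro x hx
  rw [← (hK'.isCompact i).isClosed.closure_eq, Metric.mem_closure_iff]
  intro ε hε
  obtain ⟨j, hij⟩ := C.exit_edge i
  have hρ0 : 0 ≤ ρ := (C.ratio_pos i j hij).le.trans (ht i j hij)
  have hlim : Tendsto (fun m : ℕ => ρ ^ m * Metric.diam (⋃ i, C.J i)) atTop (𝓝 0) := by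
    simpa using (tendsto_pow_atTop_nhds_zero_of_lt_one hρ0 hρ).mul_const _
  obtain ⟨m, hm⟩ := (hlim.eventually_lt_const hε).exists
  obtain ⟨y, hy, hxy⟩ := hK.exists_dist_le hK' ht m i hx
  exact ⟨y, hy, hxy.trans_lt hm⟩

theorem IsInvariant.eq_of_ratio_le (hK : C.IsInvariant K) (hK' : C.IsInvariant K') {ρ : ℝ}
    (hρ : ρ < 1) (ht : ∀ i j, C.graph.Adj i j → C.t i j ≤ ρ) : K = K' :=
  funext fun i => (hK.subset_of_ratio_le hK' hρ ht i).antisymm (hK'.subset_of_ratio_le hK hρ ht i)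

end GraphDirectedConstruction

end Uniqueness

section Overlap

theorem Overlap.mono {X : Type*} [TopologicalSpace X] {S S' T T' : Set X} (hS : S ⊆ S')
    (hT : T ⊆ T') (h : Overlap S T) : Overlap S' T' :=
  Set.Nonempty.mono (interior_mono (Set.inter_subset_inter hS hT)) h

theorem Overlap.symm {X : Type*} [TopologicalSpace X] {S T : Set X} (h : Overlap S T) :
    Overlap T S := by
  rwa [Overlap, Set.inter_comm]

theorem not_overlap_Icc {a b c d : ℝ} (h : b ≤ c) : ¬ Overlap (Set.Icc a b) (Set.Icc c d) := by
  rw [Overlap, Set.Icc_inter_Icc, interior_Icc, Set.nonempty_Ioo, not_lt]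
  exact (min_le_left _ _).trans (h.trans (le_max_right _ _))

end Overlap

section Construction

theorem ofDigits_eq_head_add_tail_div {b : ℕ} (a : ℕ → Fin b) :
    Real.ofDigits a = ((a 0 : ℕ) + Real.ofDigits fun k => a (k + 1)) / b := by
  simp [Real.ofDigits_eq_sum_add_ofDigits a 1, Real.ofDigitsTerm, div_eq_inv_mul, mul_add, mul_comm]

namespace LabeledGraph

variable {V E A : Type*} {G : LabeledGraph V E A} {v : V} {p : ℕ} {f : A → Fin p}

/-- The real numbers whose base-`p` digits are the labels along an infinite walk from `u`. -/
def walkReals (f : A → Fin p) (G : LabeledGraph V E A) (u : V) : Set ℝ :=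
  (fun e : ℕ → E => Real.ofDigits fun k => f (G.label (e k))) '' {e | G.IsWalk u e}

theorem walkReals_subset_Icc (u : V) : walkReals f G u ⊆ Set.Icc 0 1 := by
  rintro _ ⟨e, -, rfl⟩
  exact ⟨Real.ofDigits_nonneg _, Real.ofDigits_le_one _⟩

theorem isClosed_isWalk [TopologicalSpace E] [DiscreteTopology E] (G : LabeledGraph V E A)
    (u : V) : IsClosed {e | G.IsWalk u e} := by
  have hinter : {e | G.IsWalk u e} = (fun e : ℕ → E => e 0) ⁻¹' {x | G.src x = u} ∩
      ⋂ k, (fun e : ℕ → E => (e k, e (k + 1))) ⁻¹' {x | G.tgt x.1 = G.src x.2} := by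
    ext e
    simp [IsWalk]
  rw [hinter]
  refine ((isClosed_discrete _).preimage (continuous_apply 0)).inter (isClosed_iInter fun k => ?_)
  exact (isClosed_discrete _).preimage ((continuous_apply k).prodMk (continuous_apply (k + 1)))

theorem isCompact_walkReals [Finite E] (u : V) : IsCompact (walkReals f G u) := by
  let _ : TopologicalSpace E := ⊥
  have : DiscreteTopology E := ⟨rfl⟩
  refine (G.isClosed_isWalk u).isCompact.image
    (Real.continuous_ofDigits.comp (continuous_pi fun k => ?_))
  exact (continuous_of_discreteTopology (f := fun x : E => f (G.label x))).comp (continuous_apply k)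

/-- An edge is live if some infinite walk continues it. -/
abbrev LiveEdge (G : LabeledGraph V E A) : Type _ := {e : E // ∃ s, G.IsWalk (G.tgt e) s}

/-- The vertices of the graph-directed construction attached to `(G, v)`: the live edges, standing
for the position after traversing that edge, and an initial state `none` at `v`. The vertices of
`G` would not do, since a construction has at most one edge for each pair of vertices and an exit
edge at every vertex. -/
abbrev State (G : LabeledGraph V E A) : Type _ := Option G.LiveEdge

/-- The vertex of `G` at which a state is located. -/
def stateVertex (G : LabeledGraph V E A) (v : V) : G.State → V
  | none => v
  | some e => G.tgt e.1

/-- There is a transition from `i` to `j` if `j` is an edge that leaves the vertex of `i`. -/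
def StateAdj (G : LabeledGraph V E A) (v : V) (i j : G.State) : Prop :=
  ∃ e : G.LiveEdge, j = some e ∧ G.src e.1 = G.stateVertex v i

theorem IsWalk.stateAdj_head {i : G.State} {e : ℕ → E} (he : G.IsWalk (G.stateVertex v i) e) :
    G.StateAdj v i (some ⟨e 0, _, he.tail⟩) :=
  ⟨_, rfl, he.1⟩

theorem exists_isWalk_stateVertex (hv : ∃ s, G.IsWalk v s) (i : G.State) :
    ∃ s, G.IsWalk (G.stateVertex v i) s := by
  cases i with
  | none => exact hv
  | some e => exact e.2

theorem StateAdj.reachable {i j : G.State} (h : G.StateAdj v i j) :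
    (SimpleGraph.fromRel (G.StateAdj v)).Reachable i j := by
  rcases eq_or_ne i j with rfl | hne
  · rfl
  · exact SimpleGraph.Adj.reachable ((SimpleGraph.fromRel_adj _ _ _).2 ⟨hne, Or.inl h⟩)

theorem reachable_liveEdge {u : V}
    (hu : Relation.ReflTransGen (fun a b => ∃ e : E, G.src e = a ∧ G.tgt e = b) v u)
    (e : G.LiveEdge) (he : G.src e.1 = u) :
    (SimpleGraph.fromRel (G.StateAdj v)).Reachable none (some e) := by
  induction hu generalizing e with
  | refl => exact StateAdj.reachable ⟨e, rfl, he⟩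
  | tail _ hstep ih =>
    obtain ⟨e₀, hsrc, rfl⟩ := hstep
    obtain ⟨s, hs⟩ := e.2
    have hlive : ∃ s, G.IsWalk (G.tgt e₀) s := ⟨_, he ▸ hs.cons⟩
    exact (ih ⟨e₀, hlive⟩ hsrc).trans (StateAdj.reachable ⟨e, rfl, he⟩)

theorem connected_fromRel_stateAdj (hreach : G.ReachableFrom v) :
    (SimpleGraph.fromRel (G.StateAdj v)).Connected := by
  refine (SimpleGraph.connected_iff_exists_forall_reachable _).2 ⟨none, fun j => ?_⟩
  cases j with
  | none => rfl
  | some e => exact reachable_liveEdge (hreach _) e rfl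

/-- The digit of the label of a live edge, and the junk value `0` at the initial state, which no
transition enters. -/
def stateDigit (f : A → Fin p) : G.State → ℕ
  | none => 0
  | some e => f (G.label e.1)

theorem StateAdj.stateDigit_lt {i j : G.State} (h : G.StateAdj v i j) : stateDigit f j < p := by
  obtain ⟨e, rfl, -⟩ := h
  exact (f _).2

theorem StateAdj.stateDigit_ne (hf : Function.Injective f) (hG : G.RightResolving)
    {i j k : G.State} (hj : G.StateAdj v i j) (hk : G.StateAdj v i k) (hjk : j ≠ k) :
    stateDigit f j ≠ stateDigit f k := by
  obtain ⟨e, rfl, he⟩ := hj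
  obtain ⟨e', rfl, he'⟩ := hk
  exact fun h => hjk (congrArg some (Subtype.ext (hG _ _ (he.trans he'.symm) (hf (Fin.ext h)))))

theorem mem_walkReals_stateVertex_iff {i : G.State} {x : ℝ} :
    x ∈ walkReals f G (G.stateVertex v i) ↔ ∃ j, G.StateAdj v i j ∧
      ∃ y ∈ walkReals f G (G.stateVertex v j), (stateDigit f j + y) / p = x := by
  constructor
  · rintro ⟨e, he, rfl⟩
    exact ⟨_, IsWalk.stateAdj_head he, _, ⟨fun k => e (k + 1), IsWalk.tail he, rfl⟩,
      (ofDigits_eq_head_add_tail_div fun k => f (G.label (e k))).symm⟩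
  · rintro ⟨_, ⟨e, rfl, he⟩, _, ⟨s, hs, rfl⟩, rfl⟩
    exact ⟨Stream'.cons e.1 s, he ▸ IsWalk.cons hs, ofDigits_eq_head_add_tail_div _⟩

section Geometry

variable [Finite E]

/-- A numbering of the states. -/
noncomputable def stateEquiv (G : LabeledGraph V E A) : G.State ≃ Fin (Nat.card G.State) :=
  Finite.equivFin _

/-- The left end of the unit interval of a state. These intervals are pairwise disjoint, and that
of the initial state is `[0, 1]`. -/
noncomputable def stateOffset (i : G.State) : ℝ :=
  2 * ((G.stateEquiv i : ℕ) - (G.stateEquiv none : ℕ))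

/-- The unit interval of a state. -/
noncomputable def stateInterval (i : G.State) : Set ℝ := Set.Icc (stateOffset i) (stateOffset i + 1)

/-- The similarity attached to a transition from `i` to `j`. In the coordinates of the unit
intervals of `j` and `i`, it prepends the digit of `j` to a base-`p` expansion. -/
noncomputable def stateMap (f : A → Fin p) (i j : G.State) (x : ℝ) : ℝ :=
  stateOffset i + (stateDigit f j + (x - stateOffset j)) / p

theorem not_overlap_stateInterval {i j : G.State} (h : i ≠ j) :
    ¬ Overlap (stateInterval i) (stateInterval j) := by
  wlog hlt : G.stateEquiv i < G.stateEquiv j generalizing i j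
  · exact fun ho => this h.symm (lt_of_le_of_ne (not_lt.1 hlt) (G.stateEquiv.injective.ne h.symm))
      ho.symm
  refine not_overlap_Icc ?_
  have hle : ((G.stateEquiv i : ℕ) : ℝ) + 1 ≤ (G.stateEquiv j : ℕ) := by exact_mod_cast hlt
  simp only [stateOffset]
  linarith

theorem dist_stateMap (i j : G.State) (x y : ℝ) :
    dist (stateMap f i j x) (stateMap f i j y) = 1 / p * dist x y := by
  rw [stateMap, stateMap, dist_add_left, Real.dist_eq, Real.dist_eq, ← sub_div,
    add_sub_add_left_eq_sub, sub_sub_sub_cancel_right, abs_div, Nat.abs_cast, div_eq_inv_mul,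
    one_div]

theorem stateMap_image_subset_Icc (i j : G.State) :
    stateMap f i j '' stateInterval j ⊆
      Set.Icc (stateOffset i + stateDigit f j / p) (stateOffset i + (stateDigit f j + 1) / p) := by
  rintro _ ⟨x, ⟨hx0, hx1⟩, rfl⟩
  constructor <;> rw [stateMap] <;> gcongr <;> linarith

theorem StateAdj.stateMap_image_subset {i j : G.State} (h : G.StateAdj v i j) :
    stateMap f i j '' stateInterval j ⊆ stateInterval i := by
  have hlt : stateDigit f j < p := h.stateDigit_lt
  have hp0 : (0 : ℝ) < p := by exact_mod_cast (Nat.zero_le _).trans_lt hlt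
  refine (stateMap_image_subset_Icc i j).trans (Set.Icc_subset_Icc ?_ ?_)
  · exact le_add_of_nonneg_right (by positivity)
  · gcongr
    exact (div_le_one hp0).2 (by exact_mod_cast hlt)

theorem StateAdj.not_overlap_stateMap_image (hf : Function.Injective f) (hG : G.RightResolving)
    {i j k : G.State} (hj : G.StateAdj v i j) (hk : G.StateAdj v i k) (hjk : j ≠ k) :
    ¬ Overlap (stateMap f i j '' stateInterval j) (stateMap f i k '' stateInterval k) := by
  wlog hlt : stateDigit f j < stateDigit f k generalizing j k
  · exact fun ho => this hk hj hjk.symm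
      (lt_of_le_of_ne (not_lt.1 hlt) (hk.stateDigit_ne hf hG hj hjk.symm)) ho.symm
  refine fun ho => not_overlap_Icc ?_
    (ho.mono (stateMap_image_subset_Icc i j) (stateMap_image_subset_Icc i k))
  gcongr
  exact_mod_cast hlt

end Geometry

variable [hp : Fact p.Prime] [Finite E]

/-- The graph-directed construction whose sub-object at a state is the set of base-`p` expansions
that label the walks from the vertex of that state, placed in the unit interval of the state. -/
noncomputable def walkConstruction (hf : Function.Injective f) (hG : G.RightResolving)
    (hreach : G.ReachableFrom v) (hv : ∃ s, G.IsWalk v s) :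
    GraphDirectedConstruction ℝ (Nat.card G.State) where
  J i := stateInterval (G.stateEquiv.symm i)
  graph := ⟨fun i j => G.StateAdj v (G.stateEquiv.symm i) (G.stateEquiv.symm j)⟩
  T i j := stateMap f (G.stateEquiv.symm i) (G.stateEquiv.symm j)
  t _ _ := 1 / p
  isCompact_J _ := isCompact_Icc
  interior_J _ := by simp [stateInterval]
  nonoverlap_J _ _ hij := not_overlap_stateInterval (G.stateEquiv.symm.injective.ne hij)
  exit_edge i := by
    obtain ⟨s, hs⟩ := exists_isWalk_stateVertex hv (G.stateEquiv.symm i)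
    exact ⟨G.stateEquiv _, by simpa only [Equiv.symm_apply_apply] using IsWalk.stateAdj_head hs⟩
  connected := by
    let φ : SimpleGraph.fromRel (fun i j => G.StateAdj v (G.stateEquiv.symm i)
        (G.stateEquiv.symm j)) ≃g SimpleGraph.fromRel (G.StateAdj v) :=
      ⟨G.stateEquiv.symm, by simp⟩
    exact φ.connected_iff.2 (connected_fromRel_stateAdj hreach)
  ratio_pos _ _ _ := one_div_pos.2 (by exact_mod_cast hp.out.pos)
  similarity _ _ _ := dist_stateMap _ _
  nonoverlap_T _ _ _ hij hik hjk :=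
    StateAdj.not_overlap_stateMap_image hf hG hij hik (G.stateEquiv.symm.injective.ne hjk)
  image_subset _ _ := StateAdj.stateMap_image_subset
  cycle_contract q _ hq _ _ := by
    rw [Finset.prod_const, Finset.card_range, one_div]
    exact pow_lt_one₀ (by positivity)
      (inv_lt_one_of_one_lt₀ (by exact_mod_cast hp.out.one_lt)) hq.ne'

theorem isInvariant_walkConstruction (hf : Function.Injective f) (hG : G.RightResolving)
    (hreach : G.ReachableFrom v) (hv : ∃ s, G.IsWalk v s) :
    (walkConstruction hf hG hreach hv).IsInvariant fun i =>
      (fun x => stateOffset (G.stateEquiv.symm i) + x) ''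
        walkReals f G (G.stateVertex v (G.stateEquiv.symm i)) where
  isCompact i := (isCompact_walkReals _).image (by fun_prop)
  nonempty i := by
    obtain ⟨s, hs⟩ := exists_isWalk_stateVertex hv (G.stateEquiv.symm i)
    exact ⟨_, _, ⟨s, hs, rfl⟩, rfl⟩
  subset i := by
    rintro _ ⟨x, hx, rfl⟩
    obtain ⟨h0, h1⟩ := walkReals_subset_Icc _ hx
    exact ⟨by linarith, by linarith⟩
  eq_iUnion i := by
    ext z
    simp only [Set.mem_iUnion, Set.mem_image, exists_prop]
    constructor
    · rintro ⟨x, hx, rfl⟩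
      obtain ⟨j, hij, y, hy, rfl⟩ := mem_walkReals_stateVertex_iff.1 hx
      obtain ⟨j, rfl⟩ := G.stateEquiv.symm.surjective j
      exact ⟨j, hij, _, ⟨y, hy, rfl⟩, by simp [walkConstruction, stateMap]⟩
    · rintro ⟨j, hij, _, ⟨y, hy, rfl⟩, rfl⟩
      exact ⟨_, mem_walkReals_stateVertex_iff.2 ⟨_, hij, y, hy, rfl⟩,
        by simp [walkConstruction, stateMap]⟩

theorem isSubobject_walkReals (hf : Function.Injective f) (hG : G.RightResolving)
    (hreach : G.ReachableFrom v) (hv : ∃ s, G.IsWalk v s) :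
    (walkConstruction hf hG hreach hv).IsSubobject (G.stateEquiv none) (walkReals f G v) := by
  have hinv := isInvariant_walkConstruction hf hG hreach hv
  refine ⟨_, hinv, fun K' hK' => hK'.eq_of_ratio_le hinv (ρ := (p : ℝ)⁻¹)
    (inv_lt_one_of_one_lt₀ (by exact_mod_cast hp.out.one_lt)) fun _ _ _ => (one_div _).le, ?_⟩
  simp [stateOffset, stateVertex]

end LabeledGraph

open LabeledGraph

variable {V E A : Type*} {p : ℕ} [hp : Fact p.Prime] {f : A → Fin p} {G : LabeledGraph V E A}
  {v : V}

theorem iotaP_image_padicPathSet : iotaP p '' padicPathSet p f G v = walkReals f G v := by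
  ext x
  constructor
  · rintro ⟨y, hy, rfl⟩
    obtain ⟨e, he, rfl⟩ := mem_padicPathSet.1 hy
    exact ⟨e, he, (iotaP_padicOfDigits _).symm⟩
  · rintro ⟨e, he, rfl⟩
    exact ⟨_, mem_padicPathSet.2 ⟨e, he, rfl⟩, iotaP_padicOfDigits _⟩

theorem exists_isSubobject_iotaP_image [Finite E] (hf : Function.Injective f)
    (hG : G.RightResolving) (hreach : G.ReachableFrom v) (hne : (padicPathSet p f G v).Nonempty) :
    ∃ (n : ℕ) (C : GraphDirectedConstruction ℝ n) (i : Fin n),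
      (∀ j k, C.graph.Adj j k → C.t j k = 1 / (p : ℝ)) ∧
        C.IsSubobject i (iotaP p '' padicPathSet p f G v) := by
  obtain ⟨x, hx⟩ := hne
  obtain ⟨e, he, -⟩ := mem_padicPathSet.1 hx
  rw [iotaP_image_padicPathSet]
  exact ⟨_, walkConstruction hf hG hreach ⟨e, he⟩, _, fun _ _ _ => rfl,
    isSubobject_walkReals hf hG hreach ⟨e, he⟩⟩

end Construction

theorem theorem3p1 (p : ℕ) [Fact p.Prime] {V E A : Type*} [Fintype V] [DecidableEq V] [Finite E]
    (f : A → Fin p) (G : LabeledGraph V E A) (v : V) (Y : Set ℤ_[p])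
    (hstd : IsStandardPresentation p f G v Y) (hY : Y.Nonempty) :
    -- the map `iotaP` is well described, takes values in `[0, 1]` and is continuous
    (∀ a : ℕ → Fin p,
      iotaP p (padicOfDigits p a) = ∑' k, ((a k : ℕ) : ℝ) / (p : ℝ) ^ (k + 1)) ∧
    (∀ x : ℤ_[p], iotaP p x ∈ Set.Icc (0 : ℝ) 1) ∧
    Continuous (iotaP p) ∧
    -- the image of `Y` is a sub-object of a construction with all ratios `1 / p`
    (∃ (n : ℕ) (C : GraphDirectedConstruction ℝ n) (i : Fin n),
      (∀ j k, C.graph.Adj j k → C.t j k = 1 / (p : ℝ)) ∧ C.IsSubobject i (iotaP p '' Y)) ∧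
    -- Hausdorff dimension is preserved
    (∀ S : Set ℤ_[p], dimH S = dimH (iotaP p '' S)) ∧
    -- the dimension formula; the logarithm is that of a number `≥ 1`
    1 ≤ G.adjSpectralRadius ∧
    dimH Y = dimH (iotaP p '' Y) ∧
    dimH (iotaP p '' Y) = ENNReal.ofReal (Real.logb p G.adjSpectralRadius) := by
  obtain ⟨rfl, hf, hG, hreach⟩ := hstd
  refine ⟨fun a => ?_, fun x => ?_, lipschitzWith_iotaP.continuous,
    exists_isSubobject_iotaP_image hf hG hreach hY, dimH_image_iotaP,
    one_le_adjSpectralRadius hY, dimH_image_iotaP _, ?_⟩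
  · rw [iotaP_padicOfDigits]
    simp [Real.ofDigits, Real.ofDigitsTerm, div_eq_mul_inv]
  · rw [iotaP_eq_ofDigits]
    exact ⟨Real.ofDigits_nonneg _, Real.ofDigits_le_one _⟩
  · exact (dimH_image_iotaP _).symm.trans (dimH_padicPathSet hf hG hreach hY)
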